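/- Let $X$ be an irreducible smooth affine algebraic curve over $\mathbb{C}$, let $T^*X$ be its cotangent bundle with projection $p : T^*X \to X$, and regard $\mathcal{O}(X)$ as a subring of $\mathcal{O}(T^*X) = \mathrm{Sym}_{\mathcal{O}(X)}(\mathrm{Der}_{\mathbb{C}}\,\mathcal{O}(X))$ via $p^*$. An ideal $F \subseteq \mathcal{O}(T^*X)$ is called *fat* if $F \cap \mathcal{O}(X) \neq 0$. For a nonzero ideal $F$ of $\mathcal{O}(T^*X)$, the bidual $F^{**}$ (over $\mathcal{O}(T^*X)$) is an invertible module; let $\bar\gamma(F) \in \operatorname{Pic} X$ be the unique class whose image under $p^* : \operatorname{Pic} X \cong \operatorname{Pic}(T^*X)$ is the class of $F^{**}$. **Proposition 4.4.** Let $F$ be a fat ideal of $\mathcal{O}(T^*X)$. Then there is a unique ideal $I$ of $\mathcal{O}(X)$ such that $F \subseteq I\,\mathcal{O}(T^*X)$ and the complex vector space $I\,\mathcal{O}(T^*X)/F$ is finite-dimensional. Moreover, this $I$ is an invertible ideal and $\bar\gamma(F) = (I)$, the class of $I$ in $\operatorname{Pic} X$. -/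

import Mathlib

/-- For a smooth affine variety `X` over `ℂ` with coordinate ring `A = 𝒪(X)`, the ring
`𝒪(T^*X)` of regular functions on the total space of the cotangent bundle of `X`: the symmetric
algebra over `A` of the module `Der_ℂ(A)` of vector fields on `X` (a vector field is a function
on `T^*X` that is linear on the fibres).  The structure map `A → 𝒪(T^*X)` is `p^*`, where
`p : T^*X → X` is the projection. -/
abbrev CotangentFunctions (A : Type*) [CommRing A] [Algebra ℂ A] :=
  SymmetricAlgebra A (Derivation ℂ A A)

namespace CotangentFunctions

variable {A : Type*} [CommRing A] [Algebra ℂ A]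

/-- An ideal of `𝒪(T^*X)` is *fat* if its intersection with `𝒪(X)` is nonzero. -/
def IsFat (F : Ideal (CotangentFunctions A)) : Prop :=
  ∃ a : A, a ≠ 0 ∧ algebraMap A (CotangentFunctions A) a ∈ F

/-- The extended ideal `I 𝒪(T^*X)` of an ideal `I` of `𝒪(X)`. -/
abbrev extend (I : Ideal A) : Ideal (CotangentFunctions A) :=
  I.map (algebraMap A (CotangentFunctions A))

/-- The ideal `F` has finite codimension in the ideal `L`: `F` is contained in `L` and the complex
vector space `L / F` is finite-dimensional. -/
def HasFiniteCodimIn (F L : Ideal (CotangentFunctions A)) : Prop :=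
  F ≤ L ∧ FiniteDimensional ℂ (L ⧸ F.submoduleOf L)

/-- The bidual `F^{**}` of an ideal `F`, as an `𝒪(T^*X)`-module. -/
abbrev Bidual (F : Ideal (CotangentFunctions A)) :=
  Module.Dual (CotangentFunctions A) (Module.Dual (CotangentFunctions A) F)

/-- The class `c ∈ Pic X` corresponds to `F^{**}` under the pull-back `p^* : Pic X → Pic (T^*X)`:
the module `F^{**}` is invertible, and `p^* c` is its class in `Pic (T^*X)`. -/
def IsGammaBar (F : Ideal (CotangentFunctions A)) (c : CommRing.Pic A) : Prop :=
  ∃ _ : Module.Invertible (CotangentFunctions A) (Bidual F),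
    CommRing.Pic.mapAlgebra A (CotangentFunctions A) c =
      CommRing.Pic.mk (CotangentFunctions A) (Bidual F)

open Classical in
/-- The class `γ̄(F) ∈ Pic X` corresponding to `(F^{**}) ∈ Pic (T^*X)` under the isomorphism
`p^* : Pic X ≅ Pic (T^*X)` (with the value `1` if there is no such class). -/
noncomputable def gammaBar (F : Ideal (CotangentFunctions A)) : CommRing.Pic A :=
  if h : ∃ c, IsGammaBar F c then h.choose else 1

end CotangentFunctions

/-!
Write `A = 𝒪(X)`, a Dedekind domain, and `B = 𝒪(T^*X) = Sym D` with `D = Der A`, an invertible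
`A`-module.  The point is that a fat ideal can be divided by its vertical divisor: `F = I B · G`,
where `I` is the smallest ideal of `A` with `F ⊆ I B`, and `G` is a fat ideal contained in no
`𝔪 B` (`SymmetricAlgebra.exists_eq_map_mul_isHorizontal`).

A prime of `B` containing `G` lies over a closed point of `X` and is strictly larger than the prime
ideal of the fibre, an affine line, so it is maximal.  Hence `B / G` is finite-dimensional, and so
is `I B / F`, a finitely generated module over it (`IsHorizontal.finite_quotient_mul`).
Uniqueness of `I` holds because `F ⊆ I B` together with the finiteness of `J B / F` forces
`J ⊆ I`: multiplication by a vector field has to satisfy a polynomial equation with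
constant coefficients on `J B / F` (`SymmetricAlgebra.le_of_finite_quotient`).

Since the zero locus of `G` has codimension two or is empty, `I B` and `F` have the same dual
(`IsHorizontal.bijective_dualMap_inclusion`), so that `F^{**} ≅ I B ≅ p^* I`.  The class
is unique since `p^*` is split by the zero section.

In place of localization, pairs of a functional `φ : D → A` and an element `x` of `D` with
`φ x ∉ 𝔪` serve as local trivializations: `φ` induces a homomorphism `B → A[X]` that is an
isomorphism after `φ x` is inverted.  That `A` is normal follows from the local structure of smooth
algebras, as étale algebras over polynomial rings, and `D` is invertible because it embeds into `A`
by evaluation at a Noether parameter.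
-/

open scoped TensorProduct

/-! ### Normality of smooth algebras -/

/-- The generic fibre of an étale algebra is finite over the fraction field, so every element is
algebraic over the base. -/
theorem Algebra.IsAlgebraic.of_etale (R S : Type*) [CommRing R] [IsDomain R] [CommRing S]
    [Algebra R S] [Algebra.Etale R S] : Algebra.IsAlgebraic R S := by
  let K := FractionRing R
  have : Algebra.QuasiFinite K (K ⊗[R] S) := inferInstance
  have : Module.Finite K (K ⊗[R] S) := Algebra.QuasiFinite.iff_of_isArtinianRing.mp this
  refine ⟨fun s ↦ ?_⟩
  have h1 : IsAlgebraic K ((1 : K) ⊗ₜ[R] s) :=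
    (Algebra.IsIntegral.isIntegral (R := K) ((1 : K) ⊗ₜ[R] s)).isAlgebraic
  have h2 : IsAlgebraic R ((1 : K) ⊗ₜ[R] s) :=
    (IsFractionRing.isAlgebraic_iff R K _).mpr h1
  have hinj : Function.Injective (Algebra.TensorProduct.includeRight : S →ₐ[R] K ⊗[R] S) :=
    Algebra.TensorProduct.includeRight_injective (IsFractionRing.injective R K)
  exact (isAlgebraic_algHom_iff _ hinj).mp h2

/-- Clearing denominators in `S ⊗[R] Frac R`. -/
theorem TensorProduct.exists_smul_eq_tmul_one {R S : Type*} [CommRing R] [IsDomain R] [CommRing S]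
    [Algebra R S] (z : S ⊗[R] FractionRing R) : ∃ p : R, p ≠ 0 ∧ ∃ s : S, p • z = s ⊗ₜ 1 := by
  induction z with
  | zero => exact ⟨1, one_ne_zero, 0, by simp⟩
  | tmul s k =>
    obtain ⟨a, b, hb, rfl⟩ := IsFractionRing.div_surjective (A := R) k
    have hb' := nonZeroDivisors.ne_zero hb
    have : algebraMap R (FractionRing R) b ≠ 0 := by simpa using hb'
    refine ⟨b, hb', a • s, ?_⟩
    have h : b • (algebraMap R (FractionRing R) a / algebraMap R (FractionRing R) b) =
        a • (1 : FractionRing R) := by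
      rw [_root_.Algebra.smul_def, _root_.Algebra.smul_def]
      field_simp
    rw [← TensorProduct.tmul_smul, h]
    exact (TensorProduct.smul_tmul a s 1).symm
  | add z w hz hw =>
    obtain ⟨p, hp, s, hs⟩ := hz
    obtain ⟨q, hq, t, ht⟩ := hw
    refine ⟨p * q, mul_ne_zero hp hq, q • s + p • t, ?_⟩
    rw [smul_add, mul_comm p q, mul_smul, hs, mul_comm q p, mul_smul, ht, TensorProduct.add_tmul]
    simp [TensorProduct.smul_tmul']

/-- An étale domain over a normal domain is normal: `S ⊗[R] Frac R` is the fraction field of `S`,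
and forming the integral closure commutes with smooth base change, so an element of it that is
integral over `S` comes from `S ⊗[R] R`. -/
theorem IsIntegrallyClosed.of_etale (R S : Type*) [CommRing R] [IsDomain R] [IsIntegrallyClosed R]
    [CommRing S] [IsDomain S] [Algebra R S] [Algebra.Etale R S] : IsIntegrallyClosed S := by
  have : Algebra.IsAlgebraic R S := .of_etale R S
  let K := FractionRing R
  let L := FractionRing S
  have : FaithfulSMul R S := inferInstance
  have : FaithfulSMul R L := .trans R S L
  let : Algebra K L := FractionRing.liftAlgebra R L
  have : IsScalarTower R K L := FractionRing.isScalarTower_liftAlgebra R L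
  let φ : S ⊗[R] K →ₐ[S] L :=
    Algebra.TensorProduct.lift (Algebra.ofId S L) (IsScalarTower.toAlgHom R K L)
      fun _ _ ↦ Commute.all _ _
  have hφ : Function.Injective φ := by
    rw [injective_iff_map_eq_zero]
    intro z hz
    obtain ⟨p, hp, s, hs⟩ := TensorProduct.exists_smul_eq_tmul_one z
    have h1 : φ (s ⊗ₜ 1) = algebraMap S L s := by simp [φ, Algebra.ofId_apply]
    have h2 : φ (p • z) = p • φ z := by
      rw [← algebraMap_smul S p z, map_smul, algebraMap_smul]
    rw [← hs, h2, hz, smul_zero] at h1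
    have h3 : s = 0 := by simpa using h1.symm
    rw [h3, TensorProduct.zero_tmul] at hs
    have h4 : IsUnit (algebraMap R K p) := by simpa [K] using hp
    have : IsUnit ((1 : S) ⊗ₜ[R] algebraMap R K p) :=
      h4.map (Algebra.TensorProduct.includeRight : K →ₐ[R] S ⊗[R] K)
    have h6 : p • z = ((1 : S) ⊗ₜ[R] algebraMap R K p) * z := by
      rw [← Algebra.TensorProduct.includeRight_apply (A := S), AlgHom.commutes]
      exact Algebra.smul_def p z
    rwa [h6, this.mul_right_eq_zero] at hs
  rw [isIntegrallyClosed_iff L]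
  intro x hx
  obtain ⟨u, v, hv, rfl⟩ := IsFractionRing.div_surjective (A := S) x
  -- As `v` divides a nonzero constant `p`, the fraction `u / v` equals `u * w / p`,
  -- which lies in the image of `φ`.
  obtain ⟨p, hp, w, hw⟩ := (Algebra.IsAlgebraic.isAlgebraic (R := R) v).exists_nonzero_dvd hv
  have hpL : algebraMap R L p ≠ 0 := by simpa using hp
  have hy : φ ((u * w) ⊗ₜ (algebraMap R K p)⁻¹) = algebraMap S L u / algebraMap S L v := by
    have h5 : algebraMap R L p = algebraMap S L v * algebraMap S L w := by
      rw [← map_mul, ← hw, ← IsScalarTower.algebraMap_apply]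
    have : algebraMap S L w ≠ 0 := by rintro h; rw [h5, h, mul_zero] at hpL; exact hpL rfl
    simp only [φ, Algebra.TensorProduct.lift_tmul, Algebra.ofId_apply, map_mul,
      IsScalarTower.coe_toAlgHom', map_inv₀, ← IsScalarTower.algebraMap_apply]
    rw [h5, ← div_eq_mul_inv, mul_div_mul_right _ _ this]
  rw [← hy] at hx ⊢
  rw [isIntegral_algHom_iff _ hφ] at hx
  obtain ⟨y, hy⟩ := (TensorProduct.toIntegralClosure_bijective_of_smooth (R := R) (S := S)
    (B := K)).2 ⟨_, hx⟩
  have hbot : ∀ y : S ⊗[R] integralClosure R K, ∃ s : S,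
      (TensorProduct.toIntegralClosure R S K y : S ⊗[R] K) = s ⊗ₜ 1 := by
    intro y
    induction y with
    | zero => exact ⟨0, by simp⟩
    | tmul s k =>
      obtain ⟨r, hr⟩ := (isIntegrallyClosed_iff K).mp ‹_› k.2
      refine ⟨r • s, ?_⟩
      change s ⊗ₜ (k : K) = _
      rw [← hr, TensorProduct.smul_tmul, Algebra.algebraMap_eq_smul_one]
    | add a b ha hb =>
      obtain ⟨s, hs⟩ := ha
      obtain ⟨t, ht⟩ := hb
      exact ⟨s + t, by simp [hs, ht, TensorProduct.add_tmul]⟩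
  obtain ⟨s, hs⟩ := hbot y
  rw [hy] at hs
  refine ⟨s, ?_⟩
  simp only at hs
  rw [hs]
  simp [φ, Algebra.ofId_apply]

/-- A smooth domain over a unique factorization domain is normal, because near each point it is
étale over a polynomial ring. -/
theorem IsIntegrallyClosed.of_smooth (k A : Type*) [CommRing k] [IsDomain k]
    [UniqueFactorizationMonoid k] [CommRing A] [IsDomain A] [Algebra k A] [Algebra.Smooth k A] :
    IsIntegrallyClosed A := by
  refine .of_localization_maximal fun m _ _ ↦ ?_
  obtain ⟨f, hf, n, _, _, _⟩ :=
    Algebra.IsSmoothAt.exists_isStandardEtale_mvPolynomial (R := k) (p := m)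
  have hf0 : f ≠ 0 := by rintro rfl; exact hf m.zero_mem
  have : IsDomain (Localization.Away f) :=
    IsLocalization.isDomain_localization (powers_le_nonZeroDivisors_of_noZeroDivisors hf0)
  have : IsIntegrallyClosed (Localization.Away f) := .of_etale (MvPolynomial (Fin n) k) _
  have hle : Submonoid.powers f ≤ m.primeCompl := Submonoid.powers_le.mpr hf
  let := IsLocalization.localizationAlgebraOfSubmonoidLe (Localization.Away f)
    (Localization.AtPrime m) (Submonoid.powers f) m.primeCompl hle
  have := IsLocalization.localization_isScalarTower_of_submonoid_le (Localization.Away f)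
    (Localization.AtPrime m) (Submonoid.powers f) m.primeCompl hle
  have := IsLocalization.isLocalization_of_submonoid_le (Localization.Away f)
    (Localization.AtPrime m) (Submonoid.powers f) m.primeCompl hle
  refine isIntegrallyClosed_of_isLocalization (Localization.AtPrime m)
    (m.primeCompl.map (algebraMap A (Localization.Away f))) ?_
  exact map_le_nonZeroDivisors_of_injective _ (IsLocalization.injective _
    (powers_le_nonZeroDivisors_of_noZeroDivisors hf0)) m.primeCompl_le_nonZeroDivisors

/-! ### Ideals of Dedekind domains as invertible modules -/

theorem Ideal.invertible_of_mul_eq_span_singleton {R : Type*} [CommRing R] [IsDomain R]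
    {I J : Ideal R} {b : R} (hb : b ≠ 0) (h : I * J = Ideal.span {b}) :
    Module.Invertible R I := by
  let K := FractionRing R
  have hu : IsUnit (I : FractionalIdeal (nonZeroDivisors R) K) := by
    refine isUnit_of_mul_isUnit_left (y := (J : FractionalIdeal (nonZeroDivisors R) K)) ?_
    rw [← FractionalIdeal.coeIdeal_mul, h, FractionalIdeal.coeIdeal_span_singleton]
    refine IsUnit.of_mul_eq_one (FractionalIdeal.spanSingleton _ (algebraMap R K b)⁻¹) ?_
    rw [FractionalIdeal.spanSingleton_mul_spanSingleton, mul_inv_cancel₀ (by simpa [K] using hb),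
      FractionalIdeal.spanSingleton_one]
  let u : (Submodule R K)ˣ := (hu.map (FractionalIdeal.coeSubmoduleHom (nonZeroDivisors R) K)).unit
  have : Module.Invertible R (Submodule.map (Algebra.linearMap R K) I) :=
    inferInstanceAs (Module.Invertible R u)
  exact .congr (Submodule.equivMapOfInjective (Algebra.linearMap R K)
    (IsFractionRing.injective R K) I).symm

theorem Ideal.exists_mul_eq_span_singleton {R : Type*} [CommRing R] [IsDedekindDomain R]
    {I : Ideal R} (hI : I ≠ ⊥) : ∃ J : Ideal R, ∃ b : R, b ≠ 0 ∧ I * J = Ideal.span {b} := by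
  obtain ⟨b, hbI, hb⟩ := I.ne_bot_iff.mp hI
  obtain ⟨J, hJ⟩ := Ideal.dvd_span_singleton.mpr hbI
  exact ⟨J, b, hb, hJ.symm⟩

theorem Ideal.invertible_of_ne_bot {R : Type*} [CommRing R] [IsDedekindDomain R]
    {I : Ideal R} (hI : I ≠ ⊥) : Module.Invertible R I := by
  obtain ⟨J, b, hb, h⟩ := Ideal.exists_mul_eq_span_singleton hI
  exact invertible_of_mul_eq_span_singleton hb h

/-! ### Smooth curves and their vector fields -/

section Curve

variable {k A : Type*} [Field k] [CommRing A] [IsDomain A] [Algebra k A]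

theorem not_isIntegral_of_ringKrullDim_eq_one (hdim : ringKrullDim A = 1) :
    ¬ Algebra.IsIntegral k A := by
  intro h
  have := isField_of_isIntegral_of_isField' (Field.toIsField k) (S := A)
  rw [ringKrullDim_eq_zero_of_isField this] at hdim
  exact zero_ne_one hdim

theorem Ring.KrullDimLE.of_ringKrullDim_eq_one {A : Type*} [CommRing A]
    (hdim : ringKrullDim A = 1) : Ring.KrullDimLE 1 A := by
  rw [Ring.KrullDimLE, Order.krullDimLE_iff]
  exact hdim.le

theorem IsDedekindDomain.of_smooth [Algebra.FiniteType k A] [Algebra.Smooth k A]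
    (hdim : ringKrullDim A = 1) : IsDedekindDomain A :=
  have := Ring.KrullDimLE.of_ringKrullDim_eq_one hdim
  have : IsNoetherianRing A := Algebra.FiniteType.isNoetherianRing k A
  have : IsIntegrallyClosed A := .of_smooth k A
  have : Ring.DimensionLEOne A := ⟨fun h hp ↦ hp.isMaximal_of_ne_bot h⟩
  { }

theorem MvPolynomial.not_isMaximal_span_X {s : ℕ} (i j : Fin s) (hij : i ≠ j) :
    ¬ (Ideal.span {(X i : MvPolynomial (Fin s) k)}).IsMaximal := by
  intro h
  have hj : (X j : MvPolynomial (Fin s) k) ∉ Ideal.span {(X i : MvPolynomial (Fin s) k)} := by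
    intro hj
    obtain ⟨q, hq⟩ := Ideal.mem_span_singleton'.mp hj
    have := congrArg (eval (Pi.single j 1)) hq
    simp [hij] at this
  obtain ⟨y, i, hi, h⟩ := h.exists_inv hj
  obtain ⟨q, rfl⟩ := Ideal.mem_span_singleton'.mp hi
  have := congrArg (eval 0) h
  simp at this

/-- Noether normalization in dimension one: the number of variables must be `1`, since with two or
more of them a prime lying over `(X₀)` would be nonzero but not maximal. -/
theorem exists_isIntegral_mvPolynomial_one [Algebra.FiniteType k A]
    (hdim : ringKrullDim A = 1) : ∃ g : MvPolynomial (Fin 1) k →ₐ[k] A,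
      Function.Injective g ∧ g.IsIntegral := by
  have := Ring.KrullDimLE.of_ringKrullDim_eq_one hdim
  obtain ⟨s, g, hg, hint⟩ := exists_integral_inj_algHom_of_fg k A
  match s, g, hg, hint with
  | 0, g, hg, hint =>
    refine (not_isIntegral_of_ringKrullDim_eq_one (k := k) hdim ⟨fun a ↦ ?_⟩).elim
    have h0 : (algebraMap k (MvPolynomial (Fin 0) k)).IsIntegral :=
      RingHom.isIntegral_of_surjective _ (MvPolynomial.C_surjective (Fin 0))
    have := RingHom.IsIntegral.trans _ g.toRingHom h0 hint a
    rwa [show g.toRingHom.comp (algebraMap k _) = algebraMap k A from g.comp_algebraMap] at this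
  | 1, g, hg, hint => exact ⟨g, hg, hint⟩
  | s + 2, g, hg, hint =>
    exfalso
    algebraize [g.toRingHom]
    have hi : Algebra.IsIntegral (MvPolynomial (Fin (s + 2)) k) A := ⟨hint⟩
    have hX : (Ideal.span {(MvPolynomial.X 0 : MvPolynomial (Fin (s + 2)) k)}).IsPrime :=
      (Ideal.span_singleton_prime (MvPolynomial.X_ne_zero 0)).mpr (MvPolynomial.X_prime)
    obtain ⟨Q, hQ, hQX⟩ := Ideal.exists_ideal_over_prime_of_isIntegral_of_isDomain (S := A)
      (Ideal.span {(MvPolynomial.X 0 : MvPolynomial (Fin (s + 2)) k)})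
      (show RingHom.ker _ ≤ _ from (RingHom.injective_iff_ker_eq_bot _).mp hg |>.le.trans bot_le)
    rw [RingHom.algebraMap_toAlgebra] at hQX
    have hQ0 : Q ≠ ⊥ := by
      rintro rfl
      have : MvPolynomial.X 0 ∈ Ideal.span {(MvPolynomial.X 0 : MvPolynomial (Fin (s + 2)) k)} :=
        Ideal.mem_span_singleton_self _
      rw [← hQX, Ideal.mem_comap, Ideal.mem_bot] at this
      exact MvPolynomial.X_ne_zero 0 (hg (this.trans (map_zero g).symm))
    have hQm := hQ.isMaximal_of_ne_bot hQ0
    have := Ideal.isMaximal_comap_of_isIntegral_of_isMaximal (R := MvPolynomial (Fin (s + 2)) k) Q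
    rw [RingHom.algebraMap_toAlgebra, hQX] at this
    exact MvPolynomial.not_isMaximal_span_X 0 1 (by simp) this

/-- A derivation of `A` that kills a Noether parameter `x` is linear over `k[x]`, and hence zero
because `A` is separable algebraic over `k[x]`. -/
theorem exists_derivation_eval_injective [CharZero k] [Algebra.FiniteType k A]
    (hdim : ringKrullDim A = 1) : ∃ x : A, ∀ δ : Derivation k A A, δ x = 0 → δ = 0 := by
  obtain ⟨g, hg, hint⟩ := exists_isIntegral_mvPolynomial_one (k := k) hdim
  refine ⟨g (.X 0), fun δ hδ ↦ ?_⟩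
  let P := MvPolynomial (Fin 1) k
  algebraize [g.toRingHom]
  have hi : Algebra.IsIntegral P A := ⟨hint⟩
  have : FaithfulSMul P A := (faithfulSMul_iff_algebraMap_injective P A).mpr hg
  have hP : ∀ p : P, δ (algebraMap P A p) = 0 := by
    intro p
    change δ (g p) = 0
    induction p using MvPolynomial.induction_on with
    | C a =>
      have : g (MvPolynomial.C a) = algebraMap k A a := g.commutes a
      rw [this, Derivation.map_algebraMap]
    | add p q hp hq => simp [hp, hq]
    | mul_X p n hp =>
      rw [Subsingleton.elim n 0, map_mul, Derivation.leibniz, hp, hδ]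
      simp
  let δ' : Derivation P A A := .mk'
    { toFun := δ
      map_add' := map_add δ
      map_smul' := fun p a ↦ by simp [_root_.Algebra.smul_def, hP] }
    fun a b ↦ δ.leibniz a b
  ext y
  have hy : IsIntegral P y := hi.isIntegral y
  have h1 : δ' (Polynomial.aeval y (minpoly P y)) =
    Polynomial.aeval y (minpoly P y).derivative • δ' y := Derivation.map_aeval _ _ _
  rw [minpoly.aeval, map_zero, eq_comm, smul_eq_mul, mul_eq_zero] at h1
  refine h1.resolve_left fun h ↦ ?_
  -- The derivative of the minimal polynomial is nonzero and of smaller degree.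
  have hne : (minpoly P y).derivative ≠ 0 := fun h0 ↦
    (minpoly.natDegree_pos hy).ne' (Polynomial.derivative_eq_zero.mp h0)
  exact (Polynomial.degree_derivative_lt (minpoly.ne_zero hy)).not_ge
    (minpoly.IsIntegrallyClosed.degree_le_of_ne_zero hne h)

/-- If `Der A = 0`, then the projective module `Ω[A⁄k]` vanishes, so that `A` is unramified and
therefore finite over `k`, which contradicts the dimension. -/
theorem nontrivial_derivation [Algebra.FiniteType k A] [Algebra.Smooth k A]
    (hdim : ringKrullDim A = 1) : Nontrivial (Derivation k A A) := by
  by_contra h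
  rw [not_nontrivial_iff_subsingleton] at h
  have h1 : Subsingleton (Module.Dual A (Ω[A⁄k])) :=
    (KaehlerDifferential.linearMapEquivDerivation k A (M := A)).toEquiv.subsingleton
  have : Subsingleton (Ω[A⁄k]) := subsingleton_of_forall_eq 0 fun ω ↦
    (Module.forall_dual_apply_eq_zero_iff A ω).mp fun f ↦ by
      rw [Subsingleton.elim f 0, LinearMap.zero_apply]
  have : Algebra.FormallyUnramified k A := ⟨this⟩
  have : Module.Finite k A := Algebra.FormallyUnramified.finite_of_free k A
  exact not_isIntegral_of_ringKrullDim_eq_one (k := k) hdim inferInstance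

/-- Evaluation at a Noether parameter identifies `Der A` with a nonzero ideal of `A`. -/
theorem invertible_derivation [CharZero k] [Algebra.FiniteType k A] [Algebra.Smooth k A]
    (hdim : ringKrullDim A = 1) : Module.Invertible A (Derivation k A A) := by
  have := IsDedekindDomain.of_smooth (k := k) hdim
  have := nontrivial_derivation (k := k) hdim
  obtain ⟨x, hx⟩ := exists_derivation_eval_injective (k := k) hdim
  let ev : Derivation k A A →ₗ[A] A :=
    { toFun := fun δ ↦ δ x, map_add' := fun _ _ ↦ rfl, map_smul' := fun _ _ ↦ rfl }
  have hev : Function.Injective ev := (injective_iff_map_eq_zero ev).mpr hx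
  obtain ⟨δ, hδ⟩ := exists_ne (0 : Derivation k A A)
  have h0 : LinearMap.range ev ≠ ⊥ := fun h ↦ hδ (hev (by
    rw [map_zero]; exact (LinearMap.range_eq_bot.mp h) ▸ rfl))
  have : Module.Invertible A (LinearMap.range ev) := Ideal.invertible_of_ne_bot h0
  exact .congr (LinearEquiv.ofInjective ev hev).symm

end Curve

/-! ### Local trivializations of invertible modules -/

namespace Module.Invertible

variable {R M : Type*} [CommRing R] [AddCommGroup M] [Module R M] [Module.Invertible R M]

/-- The swap of `M ⊗ M` is the identity when `M` has rank one; apply `φ` to the first factor. -/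
theorem dual_apply_smul_comm (φ : Module.Dual R M) (x y : M) : φ x • y = φ y • x := by
  have h := congrArg (TensorProduct.lid R M)
    (congrArg (φ.rTensor M) (tmul_comm (R := R) (m₁ := x) (m₂ := y)))
  simpa using h

/-- The values of all functionals on an invertible module generate the unit ideal.  A pair `φ, x`
with `φ x ∉ 𝔪` plays the role of a trivialization of `M` near `𝔪`. -/
theorem exists_dual_apply_notMem {I : Ideal R} (hI : I ≠ ⊤) :
    ∃ (φ : Module.Dual R M) (x : M), φ x ∉ I := by
  by_contra! h
  refine hI ((Ideal.eq_top_iff_one I).mpr ?_)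
  obtain ⟨z, hz⟩ := (Module.Invertible.bijective (R := R) (M := M)).2 1
  have key : ∀ z, contractLeft R M z ∈ I := by
    intro z
    induction z with
    | zero => simp
    | tmul φ x => simpa using h φ x
    | add z w hz hw => rw [map_add]; exact add_mem hz hw
  exact hz ▸ key z

end Module.Invertible

/-! ### The symmetric algebra of an invertible module -/

namespace SymmetricAlgebra

open Polynomial

variable {R M : Type*} [CommRing R] [AddCommGroup M] [Module R M]

instance finiteType [Module.Finite R M] : Algebra.FiniteType R (SymmetricAlgebra R M) := by
  classical
  obtain ⟨S, hS⟩ := Module.Finite.fg_top (R := R) (M := M)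
  refine ⟨⟨S.image (ι R M), top_le_iff.mp fun f _ ↦ ?_⟩⟩
  induction f using SymmetricAlgebra.induction with
  | algebraMap r => exact Subalgebra.algebraMap_mem _ r
  | ι x =>
    have hx : x ∈ Submodule.span R (S : Set M) := hS ▸ Submodule.mem_top
    induction hx using Submodule.span_induction with
    | mem x hx => exact Algebra.subset_adjoin (by simpa using ⟨x, hx, rfl⟩)
    | zero => simp
    | add x y _ _ hx hy => rw [map_add]; exact add_mem (hx trivial) (hy trivial)
    | smul r x _ hx => rw [map_smul]; exact Subalgebra.smul_mem _ (hx trivial) r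
  | mul f g hf hg => exact mul_mem (hf trivial) (hg trivial)
  | add f g hf hg => exact add_mem (hf trivial) (hg trivial)

/-- The `R`-algebra homomorphism `Sym M → R[X]` that sends `x : M` to `φ x * X`.  Where `φ` is an
isomorphism, it is the corresponding fibre coordinate on the line bundle `Spec (Sym M)`. -/
noncomputable def toPolynomial (φ : Module.Dual R M) : SymmetricAlgebra R M →ₐ[R] R[X] :=
  lift (LinearMap.toSpanSingleton R R[X] X ∘ₗ φ)

@[simp]
theorem toPolynomial_ι (φ : Module.Dual R M) (x : M) : toPolynomial φ (ι R M x) = C (φ x) * X := by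
  simp [toPolynomial, smul_eq_C_mul]

theorem toPolynomial_aeval (φ : Module.Dual R M) (x : M) (q : R[X]) :
    toPolynomial φ (aeval (ι R M x) q) = q.comp (C (φ x) * X) := by
  rw [← aeval_algHom_apply, toPolynomial_ι]
  rfl

theorem coeff_toPolynomial_aeval (φ : Module.Dual R M) (x : M) (q : R[X]) (n : ℕ) :
    (toPolynomial φ (aeval (ι R M x) q)).coeff n = q.coeff n * φ x ^ n := by
  rw [toPolynomial_aeval, comp_C_mul_X_coeff]

theorem toPolynomial_mem_map_C {J : Ideal R} {f : SymmetricAlgebra R M} (φ : Module.Dual R M)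
    (hf : f ∈ J.map (algebraMap R (SymmetricAlgebra R M))) : toPolynomial φ f ∈ J.map C := by
  have h := Ideal.mem_map_of_mem (toPolynomial φ : SymmetricAlgebra R M →+* R[X]) hf
  rwa [Ideal.map_map, AlgHom.comp_algebraMap] at h

theorem aeval_mem_map {J : Ideal R} {B : Type*} [CommRing B] [Algebra R B] (b : B) {q : R[X]}
    (hq : q ∈ J.map C) : aeval b q ∈ J.map (algebraMap R B) := by
  have h := Ideal.mem_map_of_mem (aeval b : R[X] →ₐ[R] B).toRingHom hq
  rwa [Ideal.map_map, show (aeval b : R[X] →ₐ[R] B).toRingHom.comp C = algebraMap R B from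
    (aeval b : R[X] →ₐ[R] B).comp_algebraMap] at h

variable [Module.Invertible R M]

/-- After multiplication by a power of `φ x`, every element of `Sym M` is a polynomial in `x`,
because `φ x • y = φ y • x` in `M`. -/
theorem exists_pow_smul_eq_aeval (φ : Module.Dual R M) (x : M) (f : SymmetricAlgebra R M) :
    ∃ (N : ℕ) (q : R[X]), φ x ^ N • f = aeval (ι R M x) q := by
  induction f using SymmetricAlgebra.induction with
  | algebraMap r => exact ⟨0, C r, by simp⟩
  | ι y =>
    refine ⟨1, C (φ y) * X, ?_⟩
    rw [pow_one, ← map_smul, Module.Invertible.dual_apply_smul_comm, map_smul]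
    simp [Algebra.smul_def]
  | mul f g hf hg =>
    obtain ⟨N, q, hq⟩ := hf
    obtain ⟨N', q', hq'⟩ := hg
    exact ⟨N + N', q * q', by rw [pow_add, map_mul, ← hq, ← hq', smul_mul_smul_comm]⟩
  | add f g hf hg =>
    obtain ⟨N, q, hq⟩ := hf
    obtain ⟨N', q', hq'⟩ := hg
    refine ⟨N + N', φ x ^ N' • q + φ x ^ N • q', ?_⟩
    rw [map_add, map_smul, map_smul, ← hq, ← hq', smul_smul, smul_smul, smul_add]
    congr 2 <;> ring

/-- Up to a power of `φ x`, membership in an extended ideal `J Sym M` can be tested in `R[X]`. -/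
theorem exists_pow_smul_mem_map {J : Ideal R} {φ : Module.Dual R M} (x : M)
    {f : SymmetricAlgebra R M} (hf : toPolynomial φ f ∈ J.map C) :
    ∃ N : ℕ, φ x ^ N • f ∈ J.map (algebraMap R (SymmetricAlgebra R M)) := by
  obtain ⟨N, q, hq⟩ := exists_pow_smul_eq_aeval φ x f
  have h1 : toPolynomial φ (aeval (ι R M x) q) ∈ J.map C := by
    rw [← hq, map_smul, smul_eq_C_mul]
    exact Ideal.mul_mem_left _ _ hf
  refine ⟨q.natDegree + N, ?_⟩
  rw [pow_add, mul_smul, hq, ← map_smul]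
  refine aeval_mem_map _ (Ideal.mem_map_C_iff.mpr fun n ↦ ?_)
  rw [coeff_smul, smul_eq_mul]
  rcases le_or_gt n q.natDegree with hn | hn
  · have h2 := Ideal.mem_map_C_iff.mp h1 n
    rw [coeff_toPolynomial_aeval] at h2
    rw [← Nat.sub_add_cancel hn, pow_add, mul_assoc, mul_comm (φ x ^ n)]
    exact Ideal.mul_mem_left _ _ h2
  · rw [coeff_eq_zero_of_natDegree_lt hn, mul_zero]
    exact J.zero_mem

/-- An element whose annihilator lies in no maximal ideal is zero. -/
theorem eq_zero_of_forall_isMaximal {N : Type*} [AddCommGroup N] [Module R N] {f : N}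
    (h : ∀ m : Ideal R, m.IsMaximal → ∃ s ∉ m, s • f = 0) : f = 0 := by
  by_contra hf
  have : LinearMap.ker (LinearMap.toSpanSingleton R N f) ≠ ⊤ := by
    intro h
    have : (1 : R) ∈ LinearMap.ker (LinearMap.toSpanSingleton R N f) := h ▸ Submodule.mem_top
    simp [hf] at this
  obtain ⟨m, hm, hle⟩ := Ideal.exists_le_maximal _ this
  obtain ⟨s, hs, hsf⟩ := h m hm
  exact hs (hle (by simpa using hsf))

section IsDomain

variable [IsDomain R]

theorem toPolynomial_injective {φ : Module.Dual R M} (hφ : φ ≠ 0) :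
    Function.Injective (toPolynomial φ) := by
  rw [injective_iff_map_eq_zero]
  intro f hf
  obtain ⟨x, hx⟩ : ∃ x, φ x ≠ 0 := by
    by_contra! h
    exact hφ (LinearMap.ext h)
  have key : ∀ (ψ : Module.Dual R M) (y : M), toPolynomial ψ f = 0 → ∃ N, ψ y ^ N • f = 0 := by
    intro ψ y h
    obtain ⟨N, hN⟩ := exists_pow_smul_mem_map (J := ⊥) (φ := ψ) y (f := f) (by simp [h])
    exact ⟨N, by simpa using hN⟩
  -- If some nonzero constant kills `f`, then `f` maps to zero under every `toPolynomial ψ`,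
  -- and near each maximal ideal a suitable `ψ` shows that `f` is killed by a unit.
  obtain ⟨N, hN⟩ := key φ x hf
  refine eq_zero_of_forall_isMaximal (R := R) fun m hm ↦ ?_
  obtain ⟨ψ, y, hy⟩ := Module.Invertible.exists_dual_apply_notMem (M := M) hm.ne_top
  have h1 : toPolynomial ψ f = 0 := by
    have := congrArg (toPolynomial ψ) hN
    rw [map_smul, map_zero] at this
    exact (smul_eq_zero.mp this).resolve_left (pow_ne_zero N hx)
  obtain ⟨N', hN'⟩ := key ψ y h1
  exact ⟨_, fun h ↦ hy (hm.isPrime.mem_of_pow_mem _ h), hN'⟩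

variable (R M) in
theorem isDomain_of_invertible : IsDomain (SymmetricAlgebra R M) := by
  obtain ⟨φ, x, hx⟩ := Module.Invertible.exists_dual_apply_notMem (M := M)
    (bot_ne_top (α := Ideal R))
  have hφ : φ ≠ 0 := by rintro rfl; simp at hx
  exact (toPolynomial_injective hφ).isDomain (toPolynomial φ)

end IsDomain

theorem mem_map_iff_of_notMem {m : Ideal R} (hm : m.IsMaximal) {φ : Module.Dual R M} {x : M}
    (hx : φ x ∉ m) {f : SymmetricAlgebra R M} :
    f ∈ m.map (algebraMap R (SymmetricAlgebra R M)) ↔ toPolynomial φ f ∈ m.map C := by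
  refine ⟨toPolynomial_mem_map_C φ, fun h ↦ ?_⟩
  obtain ⟨N, hN⟩ := exists_pow_smul_mem_map x h
  obtain ⟨u, c, hc, h1⟩ := hm.exists_inv fun h ↦ hx (hm.isPrime.mem_of_pow_mem N h)
  have h2 : f = algebraMap R _ u * (φ x ^ N • f) + algebraMap R _ c * f := by
    rw [Algebra.smul_def, ← mul_assoc, ← map_mul, ← add_mul, ← map_add, h1, map_one, one_mul]
  rw [h2]
  exact add_mem (Ideal.mul_mem_left _ _ hN)
    (Ideal.mul_mem_right _ _ (Ideal.mem_map_of_mem _ hc))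

theorem isPrime_map_of_isMaximal {m : Ideal R} (hm : m.IsMaximal) :
    (m.map (algebraMap R (SymmetricAlgebra R M))).IsPrime := by
  obtain ⟨φ, x, hx⟩ := Module.Invertible.exists_dual_apply_notMem (M := M) hm.ne_top
  have h : m.map (algebraMap R (SymmetricAlgebra R M)) =
      (m.map (C : R →+* R[X])).comap (toPolynomial φ) :=
    Ideal.ext fun f ↦ mem_map_iff_of_notMem hm hx
  rw [h]
  have := hm.isPrime
  have : (m.map (C : R →+* R[X])).IsPrime := Ideal.isPrime_map_C_of_isPrime
  infer_instance

/-- The fibre `Sym M / 𝔪 Sym M` is generated by the single element `x` over `R / 𝔪`. -/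
theorem exists_sub_aeval_mem_map {m : Ideal R} (hm : m.IsMaximal) {φ : Module.Dual R M} {x : M}
    (hx : φ x ∉ m) (f : SymmetricAlgebra R M) :
    ∃ q : R[X], f - aeval (ι R M x) q ∈ m.map (algebraMap R (SymmetricAlgebra R M)) := by
  obtain ⟨N, q, hq⟩ := exists_pow_smul_eq_aeval φ x f
  obtain ⟨u, c, hc, h1⟩ := hm.exists_inv fun h ↦ hx (hm.isPrime.mem_of_pow_mem N h)
  refine ⟨u • q, ?_⟩
  have h2 : f = algebraMap R _ u * (φ x ^ N • f) + algebraMap R _ c * f := by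
    rw [Algebra.smul_def, ← mul_assoc, ← map_mul, ← add_mul, ← map_add, h1, map_one, one_mul]
  have h3 : f - aeval (ι R M x) (u • q) = algebraMap R _ c * f := by
    rw [map_smul, ← hq, Algebra.smul_def u]
    exact sub_eq_of_eq_add' h2
  rw [h3]
  exact Ideal.mul_mem_right _ _ (Ideal.mem_map_of_mem _ hc)

end SymmetricAlgebra

/-! ### Fat ideals of the symmetric algebra -/

namespace SymmetricAlgebra

open Polynomial

variable {R M : Type*} [CommRing R] [AddCommGroup M] [Module R M]

theorem mem_of_algebraMap_mem_map {I : Ideal R} {a : R}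
    (ha : algebraMap R (SymmetricAlgebra R M) a ∈ I.map (algebraMap R (SymmetricAlgebra R M))) :
    a ∈ I := by
  have h := Ideal.mem_map_of_mem (algebraMapInv (R := R) (M := M)) ha
  rw [← Ideal.map_coe (algebraMapInv (R := R) (M := M)), Ideal.map_map,
    AlgHom.comp_algebraMap] at h
  simpa using h

/-- The zero section is a retraction of the projection, so `p^*` is injective on Picard groups. -/
theorem pic_mapAlgebra_injective (R M : Type*) [CommRing R] [AddCommGroup M] [Module R M] :
    Function.Injective (CommRing.Pic.mapAlgebra R (SymmetricAlgebra R M)) := by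
  have h : (algebraMapInv : SymmetricAlgebra R M →ₐ[R] R).toRingHom.comp
      (algebraMap R (SymmetricAlgebra R M)) = RingHom.id R :=
    (algebraMapInv : SymmetricAlgebra R M →ₐ[R] R).comp_algebraMap
  intro c d hcd
  rw [← CommRing.Pic.mapRingHom_algebraMap] at hcd
  have := congrArg (CommRing.Pic.mapRingHom
    (algebraMapInv : SymmetricAlgebra R M →ₐ[R] R).toRingHom) hcd
  rwa [CommRing.Pic.mapRingHom_mapRingHom, CommRing.Pic.mapRingHom_mapRingHom, h,
    CommRing.Pic.mapRingHom_id_apply, CommRing.Pic.mapRingHom_id_apply] at this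

variable [Module.Invertible R M]

/-- If `F ⊆ I Sym M` has finite codimension in `J Sym M`, then `J ⊆ I`.  For `a ∈ J` and a section
`x` not vanishing at `𝔪`, the elements `xⁿ a` are linearly dependent modulo `F`, so `p(x) a ∈ I Sym M`
for a nonzero polynomial `p` with constant coefficients; its leading term gives `a ∈ I` near
`𝔪`. -/
theorem le_of_finite_quotient (k : Type*) [Field k] [Algebra k R] [Module k M] [IsScalarTower k R M]
    {F : Ideal (SymmetricAlgebra R M)} {I J : Ideal R}
    (hI : F ≤ I.map (algebraMap R (SymmetricAlgebra R M)))
    (hJ : Module.Finite k (J.map (algebraMap R (SymmetricAlgebra R M)) ⧸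
      F.submoduleOf (J.map (algebraMap R (SymmetricAlgebra R M))))) :
    J ≤ I := by
  intro a ha
  rw [← Ideal.Quotient.eq_zero_iff_mem]
  refine eq_zero_of_forall_isMaximal (R := R) fun m hm ↦ ?_
  obtain ⟨φ, x, hx⟩ := Module.Invertible.exists_dual_apply_notMem (M := M) hm.ne_top
  let B := SymmetricAlgebra R M
  let L := J.map (algebraMap R B)
  let a' : L := ⟨algebraMap R B a, Ideal.mem_map_of_mem _ ha⟩
  let ev : k[X] →ₗ[k] L ⧸ F.submoduleOf L :=
    ((F.submoduleOf L).mkQ.restrictScalars k) ∘ₗ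
      ((LinearMap.toSpanSingleton B L a').restrictScalars k) ∘ₗ (aeval (ι R M x)).toLinearMap
  obtain ⟨p, hp, hp0⟩ : ∃ p, ev p = 0 ∧ p ≠ 0 := by
    by_contra! h
    have hinj : Function.Injective ev := (injective_iff_map_eq_zero ev).mpr h
    have := Module.Finite.of_injective ev hinj
    exact Polynomial.not_finite this
  have h1 : aeval (ι R M x) p * algebraMap R B a ∈ F := by
    have : Submodule.Quotient.mk (p := F.submoduleOf L) (aeval (ι R M x) p • a') = 0 := hp
    rw [Submodule.Quotient.mk_eq_zero] at this
    exact this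
  have h2 := toPolynomial_mem_map_C φ (hI h1)
  rw [← aeval_map_algebraMap R, map_mul, AlgHom.commutes] at h2
  have h3 := Ideal.mem_map_C_iff.mp h2 p.natDegree
  rw [Polynomial.algebraMap_apply, coeff_mul_C, coeff_toPolynomial_aeval, coeff_map] at h3
  refine ⟨φ x ^ p.natDegree, fun h ↦ hx (hm.isPrime.mem_of_pow_mem _ h), ?_⟩
  rw [← Ideal.Quotient.mk_eq_mk, ← Submodule.Quotient.mk_smul, Ideal.Quotient.mk_eq_mk,
    Ideal.Quotient.eq_zero_iff_mem, smul_eq_mul]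
  have hu : IsUnit (algebraMap k R (p.coeff p.natDegree)) :=
    (IsUnit.mk0 _ (by simpa using hp0)).map _
  rw [Algebra.algebraMap_self_apply, mul_assoc] at h3
  exact (Ideal.unit_mul_mem_iff_mem I hu).mp h3

/-- A fat ideal of `Sym M` whose zero locus contains no fibre of the projection to `Spec R`.  When
`R` is a Dedekind domain, these are the unit ideal and the fat ideals of codimension two.  The fibre
over a maximal ideal `m` is the zero locus of the prime ideal `m Sym M`. -/
structure IsHorizontal (F : Ideal (SymmetricAlgebra R M)) : Prop where
  exists_mem : ∃ a : R, a ≠ 0 ∧ algebraMap R (SymmetricAlgebra R M) a ∈ F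
  not_le : ∀ m : Ideal R, m.IsMaximal → ¬ F ≤ m.map (algebraMap R (SymmetricAlgebra R M))

/-- Such a prime `P` lies over a maximal ideal `𝔪` of `R`, and `Sym M / P` is a quotient of the
polynomial ring `(R / 𝔪)[X]` by a nonzero prime ideal. -/
theorem IsHorizontal.isMaximal_of_le [IsDomain R] [Ring.DimensionLEOne R]
    {F : Ideal (SymmetricAlgebra R M)}
    (hF : IsHorizontal F) {P : Ideal (SymmetricAlgebra R M)} (hP : P.IsPrime) (hFP : F ≤ P) :
    P.IsMaximal := by
  let B := SymmetricAlgebra R M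
  obtain ⟨a, ha, haF⟩ := hF.exists_mem
  let m := P.comap (algebraMap R B)
  have hm : m.IsMaximal :=
    (Ideal.comap_isPrime (algebraMap R B) P).isMaximal fun h ↦ ha (by
      rw [← Ideal.mem_bot, ← h]; exact hFP haF)
  obtain ⟨φ, x, hx⟩ := Module.Invertible.exists_dual_apply_notMem (M := M) hm.ne_top
  obtain ⟨f, hfF, hfm⟩ := SetLike.not_le_iff_exists.mp (hF.not_le m hm)
  have hmP : m.map (algebraMap R B) ≤ P := Ideal.map_comap_le
  let := Ideal.Quotient.field m
  let c : R ⧸ m →+* B ⧸ P := Ideal.quotientMap P (algebraMap R B) le_rfl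
  let ψ : (R ⧸ m)[X] →+* B ⧸ P := eval₂RingHom c (Ideal.Quotient.mk P (ι R M x))
  have hψ : ∀ q : R[X], ψ (q.map (Ideal.Quotient.mk m)) =
      Ideal.Quotient.mk P (aeval (ι R M x) q) := by
    intro q
    rw [coe_eval₂RingHom, eval₂_map, aeval_def, hom_eval₂]
    rfl
  have hsurj : Function.Surjective ψ := by
    intro g
    obtain ⟨g, rfl⟩ := Ideal.Quotient.mk_surjective g
    obtain ⟨q, hq⟩ := exists_sub_aeval_mem_map hm hx g
    exact ⟨_, (hψ q).trans ((Ideal.Quotient.mk_eq_mk_iff_sub_mem _ _).mpr (hmP hq)).symm⟩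
  obtain ⟨q, hq⟩ := exists_sub_aeval_mem_map hm hx f
  have hq0 : q.map (Ideal.Quotient.mk m) ≠ 0 := by
    intro h
    have hqm : q ∈ m.map C := by
      rw [Ideal.mem_map_C_iff]
      intro n
      rw [← Ideal.Quotient.eq_zero_iff_mem, ← coeff_map, h, coeff_zero]
    exact hfm ((Submodule.sub_mem_iff_left _ (aeval_mem_map _ hqm)).mp hq)
  -- The polynomial `q` represents `f ∈ F ⊆ P`.
  have hker : q.map (Ideal.Quotient.mk m) ∈ RingHom.ker ψ := by
    rw [RingHom.mem_ker, hψ, Ideal.Quotient.eq_zero_iff_mem]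
    exact (Submodule.sub_mem_iff_right _ (hFP hfF)).mp (hmP hq)
  have hmax : (RingHom.ker ψ).IsMaximal :=
    (RingHom.ker_isPrime ψ).isMaximal fun h ↦ hq0 (by rwa [h, Ideal.mem_bot] at hker)
  rw [← Ideal.bot_quotient_isMaximal_iff]
  have hbot : (RingHom.ker ψ).map ψ = ⊥ := (Ideal.map_eq_bot_iff_le_ker ψ).mpr le_rfl
  rw [← hbot]
  refine (Ideal.map_eq_top_or_isMaximal_of_surjective ψ hsurj hmax).resolve_left ?_
  rw [hbot]
  exact bot_ne_top

/-- The quotient is a zero-dimensional algebra of finite type over `k`. -/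
theorem IsHorizontal.finite_quotient (k : Type*) [Field k] [Algebra k R] [Algebra.FiniteType k R]
    [Module k M] [IsScalarTower k R M]
    [IsDomain R] [Ring.DimensionLEOne R] {F : Ideal (SymmetricAlgebra R M)} (hF : IsHorizontal F) :
    Module.Finite k (SymmetricAlgebra R M ⧸ F) := by
  have : Algebra.FiniteType k (SymmetricAlgebra R M) := .trans (S := R) ‹_› inferInstance
  rw [Module.finite_iff_krullDimLE_zero]
  refine .mk₀ fun Q hQ ↦ ?_
  have hmax : (Q.comap (Ideal.Quotient.mk F)).IsMaximal :=
    hF.isMaximal_of_le (Ideal.comap_isPrime _ Q) fun f hf ↦ by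
      rw [Ideal.mem_comap, Ideal.Quotient.eq_zero_iff_mem.mpr hf]
      exact Q.zero_mem
  have hmap : (Q.comap (Ideal.Quotient.mk F)).map (Ideal.Quotient.mk F) = Q :=
    Ideal.map_comap_of_surjective _ Ideal.Quotient.mk_surjective Q
  have := Ideal.map_eq_top_or_isMaximal_of_surjective (Ideal.Quotient.mk F)
    Ideal.Quotient.mk_surjective hmax
  rw [hmap] at this
  exact this.resolve_left hQ.ne_top

theorem IsHorizontal.finite_quotient_mul (k : Type*) [Field k] [Algebra k R]
    [Algebra.FiniteType k R] [Module k M] [IsScalarTower k R M] [IsDomain R] [Ring.DimensionLEOne R]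
    {F : Ideal (SymmetricAlgebra R M)} (hF : IsHorizontal F) (L : Ideal (SymmetricAlgebra R M)) :
    Module.Finite k (L ⧸ (L * F).submoduleOf L) := by
  let B := SymmetricAlgebra R M
  have : Algebra.FiniteType k B := .trans (S := R) ‹_› inferInstance
  have : IsNoetherianRing B := Algebra.FiniteType.isNoetherianRing k B
  have := hF.finite_quotient k
  have htor : Module.IsTorsionBySet B (L ⧸ (L * F).submoduleOf L) F := by
    rintro y ⟨f, hf⟩
    obtain ⟨l, rfl⟩ := Submodule.Quotient.mk_surjective _ y
    rw [← Submodule.Quotient.mk_smul, Submodule.Quotient.mk_eq_zero]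
    change f * (l : B) ∈ L * F
    exact Ideal.mul_mem_mul_rev l.2 hf
  let := htor.module
  have : IsScalarTower B (B ⧸ F) (L ⧸ (L * F).submoduleOf L) := htor.isScalarTower
  have : IsScalarTower k (B ⧸ F) (L ⧸ (L * F).submoduleOf L) := htor.isScalarTower
  have : Module.Finite (B ⧸ F) (L ⧸ (L * F).submoduleOf L) := .of_restrictScalars_finite B _ _
  exact .trans (B ⧸ F) _

section Dedekind

variable [IsDedekindDomain R]

/-- A fat ideal is the product of the extension of an ideal `I` of `R` and an ideal without vertical
components.  Here `I` is minimal with `F ⊆ I Sym M`; it exists because all such `I` contain the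
given nonzero element of `F ∩ R`. -/
theorem exists_eq_map_mul_isHorizontal {F : Ideal (SymmetricAlgebra R M)}
    (hF : ∃ a : R, a ≠ 0 ∧ algebraMap R (SymmetricAlgebra R M) a ∈ F) :
    ∃ (I : Ideal R) (G : Ideal (SymmetricAlgebra R M)), I ≠ ⊥ ∧ IsHorizontal G ∧
      F = I.map (algebraMap R (SymmetricAlgebra R M)) * G := by
  let B := SymmetricAlgebra R M
  have := isDomain_of_invertible R M
  obtain ⟨a, ha, haF⟩ := hF
  let S : Set (Ideal R) := {I | F ≤ I.map (algebraMap R B)}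
  have haS : ∀ I ∈ S, a ∈ I := fun I hI ↦ mem_of_algebraMap_mem_map (hI haF)
  have hfin : S.Finite := by
    have h0 : Ideal.span {a} ≠ 0 := by simpa using ha
    have := UniqueFactorizationMonoid.fintypeSubtypeDvd _ h0
    have hfin : {I : Ideal R | I ∣ Ideal.span {a}}.Finite :=
      Set.finite_coe_iff.mp (Finite.of_fintype {x // x ∣ Ideal.span {a}})
    refine hfin.subset fun I hI ↦ ?_
    exact Ideal.dvd_span_singleton.mpr (haS I hI)
  obtain ⟨I, hI⟩ := hfin.exists_minimal ⟨⊤, by simp [S, Ideal.map_top]⟩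
  have haI := haS I hI.prop
  have hI0 : I ≠ ⊥ := fun h ↦ ha (by simpa [h] using haI)
  obtain ⟨J, b, hb, hIJ⟩ := Ideal.exists_mul_eq_span_singleton hI0
  have hb' : algebraMap R B b ≠ 0 := by simpa [B] using hb
  have hIJ' : I.map (algebraMap R B) * J.map (algebraMap R B) =
      Ideal.span {algebraMap R B b} := by
    rw [← Ideal.map_mul, hIJ, Ideal.map_span, Set.image_singleton]
  -- `G` is `I⁻¹ F`, written without fractions as `b⁻¹ (J F)`.
  let G : Ideal B := Submodule.comap (LinearMap.mulLeft B (algebraMap R B b))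
    (F * J.map (algebraMap R B) : Ideal B)
  have hG : Ideal.span {algebraMap R B b} * G = F * J.map (algebraMap R B) := by
    refine le_antisymm ?_ fun f hf ↦ ?_
    · rw [Ideal.span_singleton_mul_le_iff]
      exact fun f hf ↦ hf
    · have h1 : f ∈ Ideal.span {algebraMap R B b} := by
        rw [← hIJ']
        exact Ideal.mul_mono_left hI.prop hf
      obtain ⟨g, rfl⟩ := Ideal.mem_span_singleton.mp h1
      exact Ideal.mem_span_singleton_mul.mpr ⟨g, hf, rfl⟩
  have hFG : F = I.map (algebraMap R B) * G := by
    refine Ideal.span_singleton_mul_right_injective hb' ?_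
    change Ideal.span {algebraMap R B b} * F = Ideal.span {algebraMap R B b} * _
    rw [mul_left_comm, hG, ← hIJ']
    ring
  refine ⟨I, G, hI0, ⟨⟨a, ha, ?_⟩, fun m hm hGm ↦ ?_⟩, hFG⟩
  · change algebraMap R B b * algebraMap R B a ∈ F * J.map (algebraMap R B)
    refine Ideal.mul_mem_mul_rev haF (Ideal.mem_map_of_mem _ ?_)
    exact Ideal.mul_le_right (I := I) (hIJ ▸ Ideal.mem_span_singleton_self b)
  · have h1 : I * m ∈ S := by
      change F ≤ (I * m).map (algebraMap R B)
      rw [Ideal.map_mul, hFG]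
      exact Ideal.mul_mono_right hGm
    have h2 : I * m = I * 1 := by
      rw [mul_one]
      exact le_antisymm Ideal.mul_le_left (hI.le_of_le h1 Ideal.mul_le_left)
    have h3 : m = 1 := mul_left_cancel₀ (show I ≠ 0 from hI0) h2
    exact hm.ne_top (h3.trans Ideal.one_eq_top)

/-- An ideal without vertical components contains a nonzerodivisor modulo each `p Sym M`, as these
are prime; induction on the prime factorization of `J` then allows cancelling it modulo
`J Sym M`. -/
theorem IsHorizontal.mem_map_of_forall_mul_mem {F : Ideal (SymmetricAlgebra R M)}
    (hF : IsHorizontal F) {J : Ideal R} (hJ : J ≠ ⊥) {c : SymmetricAlgebra R M}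
    (hc : ∀ f ∈ F, c * f ∈ J.map (algebraMap R (SymmetricAlgebra R M))) :
    c ∈ J.map (algebraMap R (SymmetricAlgebra R M)) := by
  let B := SymmetricAlgebra R M
  have := isDomain_of_invertible R M
  induction J using UniqueFactorizationMonoid.induction_on_prime with
  | h₁ => exact (hJ rfl).elim
  | h₂ J hJu =>
    rw [Ideal.isUnit_iff.mp hJu, Ideal.map_top]
    exact Submodule.mem_top
  | h₃ J p hJ0 hp ih =>
    have hm : p.IsMaximal := (Ideal.isPrime_of_prime hp).isMaximal hp.ne_zero
    obtain ⟨f, hfF, hfp⟩ := SetLike.not_le_iff_exists.mp (hF.not_le p hm)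
    have hprime : (p.map (algebraMap R B)).IsPrime := isPrime_map_of_isMaximal hm
    have hcJ : c ∈ J.map (algebraMap R B) :=
      ih hJ0 fun g hg ↦ Ideal.map_mono Ideal.mul_le_right (hc g hg)
    obtain ⟨J', b, hb, hJJ'⟩ := Ideal.exists_mul_eq_span_singleton (I := J) hJ0
    have hb' : algebraMap R B b ≠ 0 := by simpa [B] using hb
    have hJJ'' : J.map (algebraMap R B) * J'.map (algebraMap R B) =
        Ideal.span {algebraMap R B b} := by
      rw [← Ideal.map_mul, hJJ', Ideal.map_span, Set.image_singleton]
    -- By induction `c ∈ J Sym M`, and `d` below is `c y / b`, a section of `c J⁻¹`;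
    -- it suffices to see that it lies in `p Sym M`.
    have key : Ideal.span {c} * J'.map (algebraMap R B) ≤
        Ideal.span {algebraMap R B b} * p.map (algebraMap R B) := by
      rw [Ideal.span_singleton_mul_le_iff]
      intro y hy
      have h1 : c * y ∈ Ideal.span {algebraMap R B b} := by
        rw [← hJJ'']; exact Ideal.mul_mem_mul hcJ hy
      obtain ⟨d, hd⟩ := Ideal.mem_span_singleton.mp h1
      have h2 : algebraMap R B b * (d * f) ∈
          Ideal.span {algebraMap R B b} * p.map (algebraMap R B) := by
        have h3 : c * f * y ∈ (p * J).map (algebraMap R B) * J'.map (algebraMap R B) :=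
          Ideal.mul_mem_mul (hc f hfF) hy
        rw [Ideal.map_mul, mul_assoc, hJJ'', mul_comm] at h3
        convert h3 using 1
        rw [← mul_assoc, ← hd]; ring
      obtain ⟨e, he, heq⟩ := Ideal.mem_span_singleton_mul.mp h2
      rw [mul_left_cancel₀ hb' heq] at he
      rw [hd]
      exact Ideal.mul_mem_mul (Ideal.mem_span_singleton_self _)
        ((hprime.mem_or_mem he).resolve_right hfp)
    have h4 : Ideal.span {algebraMap R B b} * Ideal.span {c} ≤
        Ideal.span {algebraMap R B b} * (p * J).map (algebraMap R B) := by
      calc Ideal.span {algebraMap R B b} * Ideal.span {c}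
          = (Ideal.span {c} * J'.map (algebraMap R B)) * J.map (algebraMap R B) := by
            rw [← hJJ'']; ring
        _ ≤ (Ideal.span {algebraMap R B b} * p.map (algebraMap R B)) * J.map (algebraMap R B) :=
            Ideal.mul_mono_left key
        _ = _ := by rw [Ideal.map_mul, mul_assoc]
    rw [Ideal.span_singleton_mul_right_mono hb'] at h4
    exact h4 (Ideal.mem_span_singleton_self c)

/-- Functionals on `L G` extend uniquely to `L`: for `0 ≠ a ∈ G ∩ R`, the extension of `h` has to
be `l ↦ h (a l) / a`, and this division is possible because `h (a l) g = a h (g l)` for all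
`g ∈ G`. -/
theorem IsHorizontal.bijective_dualMap_inclusion {G : Ideal (SymmetricAlgebra R M)}
    (hG : IsHorizontal G) (L : Ideal (SymmetricAlgebra R M)) :
    Function.Bijective (Submodule.inclusion (Ideal.mul_le_left : L * G ≤ L)).dualMap := by
  let B := SymmetricAlgebra R M
  have := isDomain_of_invertible R M
  obtain ⟨a, ha, haG⟩ := hG.exists_mem
  have ha' : algebraMap R B a ≠ 0 := by simpa [B] using ha
  have hmem : ∀ l : L, ∀ g ∈ G, g * (l : B) ∈ L * G := fun l g hg ↦
    Ideal.mul_mem_mul_rev l.2 hg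
  constructor
  · rw [injective_iff_map_eq_zero]
    intro h hh
    ext l
    have h1 := LinearMap.congr_fun hh ⟨_, hmem l _ haG⟩
    have h2 : h (algebraMap R B a • l) = 0 := h1
    rw [map_smul] at h2
    exact (smul_eq_zero.mp h2).resolve_left ha'
  · intro h
    have hsmul : ∀ (r : B) (y : (L * G : Ideal B)), h (r • y) = r * h y := fun r y ↦ h.map_smul r y
    have hdvd : ∀ l : L, ∃ y : B, h ⟨_, hmem l _ haG⟩ = algebraMap R B a * y := by
      intro l
      have h1 : h ⟨_, hmem l _ haG⟩ ∈ (Ideal.span {a}).map (algebraMap R B) := by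
        refine hG.mem_map_of_forall_mul_mem (by simpa using ha) fun g hg ↦ ?_
        rw [Ideal.map_span, Set.image_singleton, Ideal.mem_span_singleton]
        refine ⟨h ⟨_, hmem l g hg⟩, ?_⟩
        rw [mul_comm, ← hsmul, ← hsmul]
        exact congrArg h (Subtype.ext (mul_left_comm _ _ _))
      rw [Ideal.map_span, Set.image_singleton, Ideal.mem_span_singleton] at h1
      exact h1
    choose e he using hdvd
    refine ⟨{ toFun := e, map_add' := fun l l' ↦ ?_, map_smul' := fun r l ↦ ?_ }, ?_⟩
    · refine mul_left_cancel₀ ha' ?_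
      rw [mul_add, ← he, ← he, ← he, ← map_add]
      congr 1
      ext
      simp [mul_add]
    · refine mul_left_cancel₀ ha' ?_
      rw [RingHom.id_apply, smul_eq_mul, mul_left_comm, ← he, ← he, ← hsmul]
      exact congrArg h (Subtype.ext (mul_left_comm _ _ _))
    · ext l
      refine mul_left_cancel₀ ha' ?_
      change algebraMap R B a * e ⟨l, _⟩ = _
      exact (he _).symm.trans (hsmul _ l)

theorem invertible_map {I : Ideal R} (hI : I ≠ ⊥) :
    Module.Invertible (SymmetricAlgebra R M) (I.map (algebraMap R (SymmetricAlgebra R M))) := by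
  have := isDomain_of_invertible R M
  obtain ⟨J, b, hb, hIJ⟩ := Ideal.exists_mul_eq_span_singleton hI
  refine Ideal.invertible_of_mul_eq_span_singleton
    (J := J.map (algebraMap R (SymmetricAlgebra R M)))
    (b := algebraMap R (SymmetricAlgebra R M) b) (by simpa using hb) ?_
  rw [← Ideal.map_mul, hIJ, Ideal.map_span, Set.image_singleton]

/-- Both sides are invertible modules, so the canonical surjection between them is bijective. -/
theorem nonempty_tensorProduct_linearEquiv_map {I : Ideal R} (hI : I ≠ ⊥) :
    Nonempty (SymmetricAlgebra R M ⊗[R] I ≃ₗ[SymmetricAlgebra R M]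
      I.map (algebraMap R (SymmetricAlgebra R M))) := by
  let B := SymmetricAlgebra R M
  have := Ideal.invertible_of_ne_bot hI
  have := invertible_map (M := M) hI
  let f : I →ₗ[R] I.map (algebraMap R B) :=
    ((Algebra.linearMap R B).domRestrict I).codRestrict
      ((I.map (algebraMap R B)).restrictScalars R) fun i ↦ Ideal.mem_map_of_mem _ i.2
  have hsurj : Function.Surjective (f.liftBaseChange B) := by
    rw [← LinearMap.range_eq_top, LinearMap.range_liftBaseChange]
    refine Submodule.map_injective_of_injective (I.map (algebraMap R B)).subtype_injective ?_
    rw [Submodule.map_span, Submodule.map_top, Submodule.range_subtype]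
    change Submodule.span B _ = Submodule.span B _
    congr 1
    ext y
    constructor
    · rintro ⟨_, ⟨i, rfl⟩, rfl⟩
      exact ⟨i, i.2, rfl⟩
    · rintro ⟨i, hi, rfl⟩
      exact ⟨_, ⟨⟨i, hi⟩, rfl⟩, rfl⟩
  exact ⟨.ofBijective _ (Module.Invertible.bijective_of_surjective hsurj)⟩

end Dedekind

end SymmetricAlgebra

/-! ### The cotangent bundle of a curve -/

namespace CotangentFunctions

variable {A : Type*} [CommRing A] [Algebra ℂ A] [IsDedekindDomain A]
  [Module.Invertible A (Derivation ℂ A A)]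

/-- The bidual of `I G` is that of `I 𝒪(T^*X)`, which is reflexive and isomorphic to `p^* I`. -/
theorem isGammaBar_of_eq_map_mul {F G : Ideal (CotangentFunctions A)} {I : Ideal A}
    [Module.Invertible A I] (hI : I ≠ ⊥) (hG : SymmetricAlgebra.IsHorizontal G)
    (hF : F = extend I * G) : IsGammaBar F (CommRing.Pic.mk A I) := by
  subst hF
  let B := CotangentFunctions A
  have := SymmetricAlgebra.invertible_map (M := Derivation ℂ A A) hI
  let e₁ : Module.Dual B (extend I) ≃ₗ[B] Module.Dual B (extend I * G : Ideal B) :=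
    .ofBijective _ (hG.bijective_dualMap_inclusion (extend I))
  let e₂ : extend I ≃ₗ[B] Bidual (extend I * G) :=
    (Module.evalEquiv B (extend I)).trans e₁.symm.dualMap
  obtain ⟨e₃⟩ := SymmetricAlgebra.nonempty_tensorProduct_linearEquiv_map
    (M := Derivation ℂ A A) hI
  have : Module.Invertible B (Bidual (extend I * G)) := .congr e₂
  refine ⟨this, ?_⟩
  rw [CommRing.Pic.mapAlgebra_apply, CommRing.Pic.mk_eq_mk_iff]
  exact ⟨((CommRing.Pic.mk.linearEquiv A I).baseChange A B _ _).trans (e₃.trans e₂)⟩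

end CotangentFunctions

open CotangentFunctions in
theorem proposition4p4 {A : Type*} [CommRing A] [IsDomain A] [Algebra ℂ A]
    [Algebra.FiniteType ℂ A] [Algebra.Smooth ℂ A] (hdim : ringKrullDim A = 1)
    (F : Ideal (CotangentFunctions A)) (hF : CotangentFunctions.IsFat F) :
    (∃! I : Ideal A, CotangentFunctions.HasFiniteCodimIn F (CotangentFunctions.extend I)) ∧
    (∃! c : CommRing.Pic A, CotangentFunctions.IsGammaBar F c) ∧
    ∀ I : Ideal A, CotangentFunctions.HasFiniteCodimIn F (CotangentFunctions.extend I) →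
      ∃ _ : Module.Invertible A I, CotangentFunctions.gammaBar F = CommRing.Pic.mk A I := by
  have : IsDedekindDomain A := .of_smooth (k := ℂ) hdim
  have : Module.Invertible A (Derivation ℂ A A) := invertible_derivation hdim
  obtain ⟨I, G, hI, hG, rfl⟩ := SymmetricAlgebra.exists_eq_map_mul_isHorizontal hF
  have hcodim : HasFiniteCodimIn (extend I * G) (extend I) :=
    ⟨Ideal.mul_le_left, hG.finite_quotient_mul ℂ _⟩
  have huniq : ∀ J, HasFiniteCodimIn (extend I * G) (extend J) → J = I := fun J hJ ↦
    le_antisymm (SymmetricAlgebra.le_of_finite_quotient ℂ hcodim.1 hJ.2)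
      (SymmetricAlgebra.le_of_finite_quotient ℂ hJ.1 hcodim.2)
  have hinv : Module.Invertible A I := Ideal.invertible_of_ne_bot hI
  have hγ : IsGammaBar (extend I * G) (CommRing.Pic.mk A I) :=
    isGammaBar_of_eq_map_mul hI hG rfl
  have hγuniq : ∀ c, IsGammaBar (extend I * G) c → c = CommRing.Pic.mk A I := by
    rintro c ⟨_, hc⟩
    obtain ⟨_, hc'⟩ := hγ
    exact SymmetricAlgebra.pic_mapAlgebra_injective A _ (hc.trans hc'.symm)
  refine ⟨⟨I, hcodim, huniq⟩, ⟨_, hγ, hγuniq⟩, fun J hJ ↦ ?_⟩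
  obtain rfl := huniq J hJ
  refine ⟨hinv, ?_⟩
  have h : ∃ c, IsGammaBar (extend J * G) c := ⟨_, hγ⟩
  rw [gammaBar, dif_pos h]
  exact hγuniq _ h.choose_spec
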